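/- For vectors $f:\mathcal X\to\mathbb R^3$ ($\mathcal X\subseteq\mathbb R$ an interval) and a positive definite $3\times3$ matrix $\Sigma$, put $$\psi_\Sigma(x)=\frac{\Sigma^{1/2}f(x)}{\|\Sigma^{1/2}f(x)\|},\qquad \gamma_\Sigma=\{\pm\psi_\Sigma(x)\mid x\in\mathcal X\},\qquad \mathrm{Vol}_1(\gamma_\Sigma)=2\int_{\mathcal X}\Bigl\|\frac{\mathrm d\psi_\Sigma(x)}{\mathrm dx}\Bigr\|\,\mathrm dx ,$$ with the Euclidean norm, and let $$\mathcal M=\Bigl\{\int_{\mathcal X}f(x)f(x)^\top\,\mathrm d\rho(x)\succ0\ \Bigm|\ \rho\text{ a finite nonnegative measure on }\mathcal X\text{ for which the integral exists}\Bigr\}$$ be the set of non-singular information matrices. For polynomial regression, $f(x)=f_P(x)=(1,x,x^2)^\top$ on $\mathcal X=\mathbb R$, write $\mathcal M=\mathcal M_P$ (the moment cone) and $\mathrm{Vol}_1=\mathrm{Vol}_P$. For Fourier regression, $f(t)=f_F(t)=(1,\sqrt2\sin 2\pi t,\sqrt2\cos2\pi t)^\top$ on $\mathcal X=(-\tfrac12,\tfrac12]$,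 write $\mathcal M=\mathcal M_F$ and $\mathrm{Vol}_1=\mathrm{Vol}_F$. Let $$A(a,b,c,d)=\begin{pmatrix}d^2&2cd&c^2\\ bd&bc+ad&ac\\ b^2&2ab&a^2\end{pmatrix},\qquad B=\begin{pmatrix}1&0&1\\0&2\sqrt2&0\\ \sqrt2&0&-\sqrt2\end{pmatrix},\qquad M_{1/3}=\begin{pmatrix}1&0&\frac13\\0&\frac13&0\\\frac13&0&1\end{pmatrix},$$ so that $f_P\bigl(\frac{ax+b}{cx+d}\bigr)=(cx+d)^{-2}A(a,b,c,d)f_P(x)$ and $f_F(t)=(1+x^2)^{-1}Bf_P(x)$ for $x=\tan(\pi t)$. Let $$\mathcal A(M_{1/3})=\{A M_{1/3}A^\top\mid A=A(a,b,c,d),\ a,b,c,d\in\mathbb R,\ ad-bc\neq0\}$$ be the Möbius orbit of $M_{1/3}$. **Theorem.** The set of minimizers of $M\mapsto\mathrm{Vol}_P(\gamma_{M^{-1}})$ over $M\in\mathcal M_P$ is exactly the orbit $\mathcal A(M_{1/3})$, and the minimum is $4\pi\sqrt{2/3}$. Equivalently, for the three-term Fourier regression, the set of minimizers of $M\mapsto\mathrm{Vol}_F(\gamma_{M^{-1}})$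 over $M\in\mathcal M_F$ is exactly $\{BMB^\top\mid M\in\mathcal A(M_{1/3})\}$, and the minimum is again $4\pi\sqrt{2/3}$. -/

import Mathlib

open MeasureTheory
open scoped Matrix MatrixOrder ENNReal

noncomputable section

/-- The normalized basis vector `ψ_Σ(x) = Σ^{1/2} f(x) / ‖Σ^{1/2} f(x)‖` (Euclidean norm), where
`Σ^{1/2}` is the positive semidefinite square root of `Σ`. -/
def normalizedBasis {n : ℕ} (f : ℝ → Fin n → ℝ) (S : Matrix (Fin n) (Fin n) ℝ) (x : ℝ) :
    EuclideanSpace ℝ (Fin n) :=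
  ‖WithLp.toLp 2 (CFC.sqrt S *ᵥ f x)‖⁻¹ • WithLp.toLp 2 (CFC.sqrt S *ᵥ f x)

/-- The tube volume `Vol₁(γ_Σ) = 2 ∫_X ‖ψ_Σ'(x)‖ dx ∈ [0, ∞]`, i.e. the length of
`γ_Σ = {± ψ_Σ(x) | x ∈ X}`. -/
def tubeVolume {n : ℕ} (X : Set ℝ) (f : ℝ → Fin n → ℝ) (S : Matrix (Fin n) (Fin n) ℝ) : ℝ≥0∞ :=
  2 * ∫⁻ x in X, ‖deriv (normalizedBasis f S) x‖ₑ

/-- The set of nonsingular information matrices: the positive definite matrices of the form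
`∫_X f(x) f(x)ᵀ dρ(x)` for a finite nonnegative measure `ρ` on `X` for which the integral exists. -/
def informationMatrices {n : ℕ} (X : Set ℝ) (f : ℝ → Fin n → ℝ) :
    Set (Matrix (Fin n) (Fin n) ℝ) :=
  {M | M.PosDef ∧ ∃ ρ : Measure ℝ, IsFiniteMeasure ρ ∧
    (∀ i j, IntegrableOn (fun x => f x i * f x j) X ρ) ∧
    ∀ i j, M i j = ∫ x in X, f x i * f x j ∂ρ}

/-- The polynomial basis `(1, x, x²)` (on the domain `ℝ`). -/
def polyVec (x : ℝ) : Fin 3 → ℝ := ![1, x, x ^ 2]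

/-- The Fourier basis `(1, √2 sin 2πt, √2 cos 2πt)` (on the domain `(-1/2, 1/2]`). -/
def fourierVec (t : ℝ) : Fin 3 → ℝ :=
  ![1, √2 * Real.sin (2 * Real.pi * t), √2 * Real.cos (2 * Real.pi * t)]

/-- The moment cone `M_P`. -/
def momentConeP : Set (Matrix (Fin 3) (Fin 3) ℝ) := informationMatrices Set.univ polyVec

/-- The set `M_F` of information matrices of the Fourier regression. -/
def momentConeF : Set (Matrix (Fin 3) (Fin 3) ℝ) :=
  informationMatrices (Set.Ioc (-1 / 2) (1 / 2)) fourierVec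

/-- `M ↦ Vol₁(γ_{M⁻¹})` for the polynomial regression. -/
def volP (M : Matrix (Fin 3) (Fin 3) ℝ) : ℝ≥0∞ := tubeVolume Set.univ polyVec M⁻¹

/-- `M ↦ Vol₁(γ_{M⁻¹})` for the Fourier regression. -/
def volF (M : Matrix (Fin 3) (Fin 3) ℝ) : ℝ≥0∞ :=
  tubeVolume (Set.Ioc (-1 / 2) (1 / 2)) fourierVec M⁻¹

/-- The matrix `A(a,b,c,d)` by which the Möbius transformation `φ(x) = (ax+b)/(cx+d)` acts:
`(cx+d)² f(φ(x)) = A(a,b,c,d) f(x)` for `f(x) = (1, x, x²)`. -/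
def mobiusMatrix (a b c d : ℝ) : Matrix (Fin 3) (Fin 3) ℝ :=
  !![d ^ 2, 2 * c * d, c ^ 2;
     b * d, b * c + a * d, a * c;
     b ^ 2, 2 * a * b, a ^ 2]

/-- The Möbius orbit `{A M Aᵀ | A = A(a,b,c,d), ad - bc ≠ 0}` of `M`. -/
def mobiusOrbit (M : Matrix (Fin 3) (Fin 3) ℝ) : Set (Matrix (Fin 3) (Fin 3) ℝ) :=
  {N | ∃ a b c d : ℝ, a * d - b * c ≠ 0 ∧ N = mobiusMatrix a b c d * M * (mobiusMatrix a b c d)ᵀ}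

/-- The matrix `M_{1/3}`. -/
def matrixThird : Matrix (Fin 3) (Fin 3) ℝ :=
  !![1, 0, 1 / 3;
     0, 1 / 3, 0;
     1 / 3, 0, 1]

/-- The matrix `B` linking the two bases: for `x = tan(πt)`, the Fourier basis at `t` equals
`(1+x²)⁻¹ B (1, x, x²)ᵀ`. -/
def fourierPolyMatrix : Matrix (Fin 3) (Fin 3) ℝ :=
  !![1, 0, 1;
     0, 2 * √2, 0;
     √2, 0, -√2]

end

/-!
Write `f = (1, x, x²)`. Every information matrix of the polynomial regression is a positive definite
Hankel matrix, and an information matrix of the Fourier regression is `B N Bᵀ` with `N` of that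
kind (`exists_eq_conj_of_mem_momentConeF`). So it suffices to bound `volP` from below on all
positive definite Hankel matrices, and to show that the orbit of `M_{1/3}` consists of information
matrices of both kinds; for the latter, explicit measures with three atoms serve
(`exists_atoms_of_mem_mobiusOrbit_matrixThird`).

The length of the normalized curve depends neither on a scalar factor of `f` nor on the
parametrization, so `volP` is invariant under the Möbius action and is carried to `volF` by
`x = tan (π t)` (`tubeVolume_reparam`). Every positive definite Hankel matrix is Möbius equivalent
to the one with moments `(1, 0, a, 0, 1)` for some `0 < a < 1`
(`exists_mem_mobiusOrbit_normalForm`): the pencil spanned by it and the discriminant form has a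
definite quadratic polynomial as an eigenvector, which can be moved to `x² + 1`, and a rotation then
removes the odd moments.

At the normal form, put `y = (x - x⁻¹) / R` with `R² = (1 - a)(1 + 3a) / a`, a two-to-one
parametrization of the line, and `v = 1 / (1 + y²)`. The length element becomes `√H dy / (1 + y²)`,
where `H` is a concave function of `v ∈ [0, 1]` with `H(0) = (1 + a) / (1 + 3a)` and
`H(1) = (1 + a) / 2`. Bounding the concave function `√H` by its chord (`chord_le_gramSpeed`) and
using that `v` has mean `1/2` with respect to the Cauchy distribution gives the lower bound
`2π (√H(0) + √H(1))`. By the inequality of arithmetic and geometric means this is at least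
`4π (H(0) H(1))^(1/4)`, and `H(0) H(1) = (1 + a)² / (2 (1 + 3a)) ≥ 4/9` because
`(3a - 1)² ≥ 0`, with equality only at `a = 1/3` (`two_mul_sqrt_lt`). At `a = 1/3` the speed is
`√(8/3) / (1 + x²)` and the length is equal to the bound (`volP_matrixThird`).
-/

/-! ### The speed of a normalized curve -/

/-- The derivative of a normalized curve `g / ‖g‖` has norm `√(‖g‖²‖g'‖² - ⟪g, g'⟫²) / ‖g‖²`, the
Gram determinant being the squared area of the parallelogram spanned by `g` and `g'`. -/
theorem norm_deriv_normalize {E : Type*} [NormedAddCommGroup E] [InnerProductSpace ℝ E]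
    {g : ℝ → E} {g' : E} {x : ℝ} (hg : HasDerivAt g g' x) (h0 : g x ≠ 0) :
    ‖deriv (fun y => ‖g y‖⁻¹ • g y) x‖ =
      √(inner ℝ (g x) (g x) * inner ℝ g' g' - inner ℝ (g x) g' ^ 2) / inner ℝ (g x) (g x) := by
  have hn : 0 < ‖g x‖ := norm_pos_iff.mpr h0
  have hnorm : HasDerivAt (fun y => ‖g y‖) (inner ℝ (g x) g' / ‖g x‖) x := by
    have h1 := (hg.norm_sq).sqrt (by positivity)
    have h2 : (fun y => √(‖g y‖ ^ 2)) = fun y => ‖g y‖ := by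
      funext y; exact Real.sqrt_sq (norm_nonneg _)
    rw [h2, Real.sqrt_sq (norm_nonneg _)] at h1
    convert h1 using 1
    field_simp
  have hd := (hnorm.inv hn.ne').smul hg
  have hd' : deriv (fun y => ‖g y‖⁻¹ • g y) x =
      ‖g x‖⁻¹ • g' + (-(inner ℝ (g x) g' / ‖g x‖) / ‖g x‖ ^ 2) • g x := hd.deriv
  have hs : inner ℝ (g x) (g x) = √((‖g x‖ ^ 2) ^ 2) := by
    rw [Real.sqrt_sq (by positivity), real_inner_self_eq_norm_sq]
  rw [hd', ← Real.sqrt_sq (norm_nonneg (_ + _)), ← real_inner_self_eq_norm_sq]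
  nth_rewrite 2 [hs]
  rw [← Real.sqrt_div' _ (by positivity)]
  congr 1
  simp only [inner_add_left, inner_add_right, inner_smul_left, inner_smul_right,
    real_inner_comm (g x) g', real_inner_self_eq_norm_sq (g x), conj_trivial]
  field_simp
  ring

/-- The speed `√(β(u,u) β(w,w) - β(u,w)²) / β(u,u)`, with `β(u,w) = uᵀ S w`, of the normalized
curve at a point with position `u` and velocity `w`. -/
noncomputable def gramSpeed {n : ℕ} (S : Matrix (Fin n) (Fin n) ℝ) (u w : Fin n → ℝ) : ℝ :=
  √((u ⬝ᵥ S *ᵥ u) * (w ⬝ᵥ S *ᵥ w) - (u ⬝ᵥ S *ᵥ w) ^ 2) / (u ⬝ᵥ S *ᵥ u)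

theorem inner_sqrt_mulVec {n : ℕ} {S : Matrix (Fin n) (Fin n) ℝ} (hS : S.PosSemidef)
    (u w : Fin n → ℝ) :
    inner ℝ (WithLp.toLp 2 (CFC.sqrt S *ᵥ u)) (WithLp.toLp 2 (CFC.sqrt S *ᵥ w)) =
      u ⬝ᵥ S *ᵥ w := by
  have h0 : 0 ≤ S := Matrix.nonneg_iff_posSemidef.mpr hS
  have hsa : (CFC.sqrt S)ᵀ = CFC.sqrt S := by
    have := (Matrix.nonneg_iff_posSemidef.mp (CFC.sqrt_nonneg S)).isHermitian
    rwa [Matrix.IsHermitian, Matrix.conjTranspose_eq_transpose_of_trivial] at this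
  rw [EuclideanSpace.inner_toLp_toLp, star_trivial, dotProduct_comm]
  nth_rewrite 1 [← hsa]
  rw [Matrix.mulVec_transpose, ← Matrix.dotProduct_mulVec, Matrix.mulVec_mulVec,
    CFC.sqrt_mul_sqrt_self S h0]

theorem norm_deriv_normalizedBasis {n : ℕ} {S : Matrix (Fin n) (Fin n) ℝ} (hS : S.PosDef)
    {f : ℝ → Fin n → ℝ} {f' : Fin n → ℝ} {x : ℝ} (hf : HasDerivAt f f' x) (h0 : f x ≠ 0) :
    ‖deriv (normalizedBasis f S) x‖ = gramSpeed S (f x) f' := by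
  have hg : HasDerivAt (fun y => WithLp.toLp 2 (CFC.sqrt S *ᵥ f y))
      (WithLp.toLp 2 (CFC.sqrt S *ᵥ f')) x :=
    (((PiLp.continuousLinearEquiv 2 ℝ (fun _ : Fin n => ℝ)).symm.toContinuousLinearMap.comp
      (Matrix.mulVecLin (CFC.sqrt S)).toContinuousLinearMap).hasFDerivAt.comp_hasDerivAt x hf)
  have hne : WithLp.toLp 2 (CFC.sqrt S *ᵥ f x) ≠ 0 := by
    rw [← inner_self_ne_zero (𝕜 := ℝ), inner_sqrt_mulVec hS.posSemidef]
    simpa using (hS.dotProduct_mulVec_pos h0).ne'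
  have := norm_deriv_normalize hg hne
  rw [inner_sqrt_mulVec hS.posSemidef, inner_sqrt_mulVec hS.posSemidef,
    inner_sqrt_mulVec hS.posSemidef] at this
  exact this

theorem tubeVolume_eq_lintegral_gramSpeed {n : ℕ} {S : Matrix (Fin n) (Fin n) ℝ} (hS : S.PosDef)
    (X : Set ℝ) {f f' : ℝ → Fin n → ℝ} (hf : ∀ x, HasDerivAt f (f' x) x) (h0 : ∀ x, f x ≠ 0) :
    tubeVolume X f S = 2 * ∫⁻ x in X, ENNReal.ofReal (gramSpeed S (f x) (f' x)) := by
  unfold tubeVolume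
  congr 1
  refine lintegral_congr fun x => ?_
  rw [← norm_deriv_normalizedBasis hS (hf x) (h0 x), ofReal_norm]

/-! ### Invariance under reparametrization and linear change of basis -/

theorem dotProduct_conj_inv_mulVec {n : ℕ} {A M : Matrix (Fin n) (Fin n) ℝ} (hA : IsUnit A.det)
    (u w : Fin n → ℝ) :
    (A *ᵥ u) ⬝ᵥ (A * M * Aᵀ)⁻¹ *ᵥ (A *ᵥ w) = u ⬝ᵥ M⁻¹ *ᵥ w := by
  rw [Matrix.mul_inv_rev, Matrix.mul_inv_rev, Matrix.mulVec_mulVec, Matrix.mul_assoc,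
    Matrix.mul_assoc, Matrix.nonsing_inv_mul _ hA, Matrix.mul_one, ← Matrix.mulVec_mulVec,
    Matrix.dotProduct_mulVec, ← Matrix.mulVec_transpose, Matrix.mulVec_mulVec,
    ← Matrix.transpose_nonsing_inv, Matrix.transpose_transpose, Matrix.nonsing_inv_mul _ hA,
    Matrix.one_mulVec]

/-- The speed transforms as the derivative of the parameter change: if `f₂ ∘ φ = l • A f₁`, then
`u₂ = l A u` and `φ' w₂ = l' A u + l A w` are the positions and velocities; the scalar factor `l`
and the added multiple of the position do not change the direction of the curve. -/
theorem gramSpeed_transform {n : ℕ} {A M : Matrix (Fin n) (Fin n) ℝ} (hA : IsUnit A.det)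
    (hM : M.PosDef) {u w u2 w2 : Fin n → ℝ} {l l' c : ℝ} (hl : l ≠ 0)
    (hu : u2 = l • A *ᵥ u) (hw : c • w2 = l' • A *ᵥ u + l • A *ᵥ w) :
    |c| * gramSpeed (A * M * Aᵀ)⁻¹ u2 w2 = gramSpeed M⁻¹ u w := by
  have hsymm : w ⬝ᵥ M⁻¹ *ᵥ u = u ⬝ᵥ M⁻¹ *ᵥ w := by
    have : (M⁻¹)ᵀ = M⁻¹ := by
      rw [← Matrix.conjTranspose_eq_transpose_of_trivial]
      exact hM.inv.isHermitian
    rw [Matrix.dotProduct_mulVec, ← Matrix.mulVec_transpose, this, dotProduct_comm]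
  set T := (A * M * Aᵀ)⁻¹ with hT
  have huu : u2 ⬝ᵥ T *ᵥ u2 = l ^ 2 * (u ⬝ᵥ M⁻¹ *ᵥ u) := by
    simp only [hu, Matrix.mulVec_smul, dotProduct_smul, smul_dotProduct, smul_eq_mul, hT,
      dotProduct_conj_inv_mulVec hA]
    ring
  have huw : c * (u2 ⬝ᵥ T *ᵥ w2) = l * l' * (u ⬝ᵥ M⁻¹ *ᵥ u) + l ^ 2 * (u ⬝ᵥ M⁻¹ *ᵥ w) := by
    have : c * (u2 ⬝ᵥ T *ᵥ w2) = u2 ⬝ᵥ T *ᵥ (c • w2) := by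
      rw [Matrix.mulVec_smul, dotProduct_smul, smul_eq_mul]
    rw [this]
    simp only [hu, hw, Matrix.mulVec_smul, Matrix.mulVec_add, dotProduct_add, dotProduct_smul,
      smul_dotProduct, smul_eq_mul, hT, dotProduct_conj_inv_mulVec hA]
    ring
  have hww : c ^ 2 * (w2 ⬝ᵥ T *ᵥ w2) = l' ^ 2 * (u ⬝ᵥ M⁻¹ *ᵥ u)
      + 2 * l * l' * (u ⬝ᵥ M⁻¹ *ᵥ w) + l ^ 2 * (w ⬝ᵥ M⁻¹ *ᵥ w) := by
    have : c ^ 2 * (w2 ⬝ᵥ T *ᵥ w2) = (c • w2) ⬝ᵥ T *ᵥ (c • w2) := by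
      rw [Matrix.mulVec_smul, dotProduct_smul, smul_dotProduct, smul_eq_mul, smul_eq_mul]
      ring
    rw [this]
    simp only [hw, Matrix.mulVec_smul, Matrix.mulVec_add, dotProduct_add, add_dotProduct,
      dotProduct_smul, smul_dotProduct, smul_eq_mul, hT, dotProduct_conj_inv_mulVec hA, hsymm]
    ring
  unfold gramSpeed
  rw [← mul_div_assoc, ← Real.sqrt_sq_eq_abs, ← Real.sqrt_mul (sq_nonneg c), huu]
  have key : c ^ 2 * (l ^ 2 * (u ⬝ᵥ M⁻¹ *ᵥ u) * (w2 ⬝ᵥ T *ᵥ w2) - (u2 ⬝ᵥ T *ᵥ w2) ^ 2) =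
      (l ^ 2) ^ 2 * ((u ⬝ᵥ M⁻¹ *ᵥ u) * (w ⬝ᵥ M⁻¹ *ᵥ w) - (u ⬝ᵥ M⁻¹ *ᵥ w) ^ 2) := by
    have : c ^ 2 * (l ^ 2 * (u ⬝ᵥ M⁻¹ *ᵥ u) * (w2 ⬝ᵥ T *ᵥ w2) - (u2 ⬝ᵥ T *ᵥ w2) ^ 2) =
      l ^ 2 * (u ⬝ᵥ M⁻¹ *ᵥ u) * (c ^ 2 * (w2 ⬝ᵥ T *ᵥ w2)) - (c * (u2 ⬝ᵥ T *ᵥ w2)) ^ 2 := by ring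
    rw [this, hww, huw]
    ring
  rw [key, Real.sqrt_mul (by positivity), Real.sqrt_sq (by positivity),
    mul_div_mul_left _ _ (by positivity)]

theorem posDef_conj {n : ℕ} {A M : Matrix (Fin n) (Fin n) ℝ} (hA : IsUnit A.det)
    (hM : M.PosDef) : (A * M * Aᵀ).PosDef := by
  have h := hM.mul_mul_conjTranspose_same (B := A)
    (Matrix.vecMul_injective_of_isUnit ((Matrix.isUnit_iff_isUnit_det A).mpr hA))
  rwa [Matrix.conjTranspose_eq_transpose_of_trivial] at h

/-- If `f₂ ∘ φ = l • A f₁` on an open set `X` that is a.e. equal to `X₁` and is mapped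
bijectively onto a set a.e. equal to `X₂`, then the tube volume of `f₂` at `(A M Aᵀ)⁻¹` is the
one of `f₁` at `M⁻¹`. -/
theorem tubeVolume_reparam {n : ℕ} {X X1 X2 : Set ℝ} (hX : IsOpen X)
    (hX1 : X =ᵐ[volume] X1) {f1 f1' f2 f2' : ℝ → Fin n → ℝ}
    (hf1 : ∀ x, HasDerivAt f1 (f1' x) x) (hf2 : ∀ x, HasDerivAt f2 (f2' x) x)
    (h1 : ∀ x, f1 x ≠ 0) (h2 : ∀ x, f2 x ≠ 0)
    {A M : Matrix (Fin n) (Fin n) ℝ} (hA : IsUnit A.det) (hM : M.PosDef)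
    {φ φ' l l' : ℝ → ℝ} (hφ : ∀ x ∈ X, HasDerivAt φ (φ' x) x) (hinj : Set.InjOn φ X)
    (himg : φ '' X =ᵐ[volume] X2) (hl : ∀ x ∈ X, HasDerivAt l (l' x) x)
    (hl0 : ∀ x ∈ X, l x ≠ 0) (h : ∀ x ∈ X, f2 (φ x) = l x • A *ᵥ f1 x) :
    tubeVolume X2 f2 (A * M * Aᵀ)⁻¹ = tubeVolume X1 f1 M⁻¹ := by
  rw [tubeVolume_eq_lintegral_gramSpeed (posDef_conj hA hM).inv X2 hf2 h2,
    tubeVolume_eq_lintegral_gramSpeed hM.inv X1 hf1 h1, ← Measure.restrict_congr_set himg,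
    ← Measure.restrict_congr_set hX1, lintegral_image_eq_lintegral_abs_deriv_mul
      hX.measurableSet (fun x hx => (hφ x hx).hasDerivWithinAt) hinj]
  congr 1
  refine setLIntegral_congr_fun hX.measurableSet fun x hx => ?_
  rw [← ENNReal.ofReal_mul (abs_nonneg _)]
  congr 1
  refine gramSpeed_transform (l' := l' x) hA hM (hl0 x hx) (h x hx) ?_
  have hd1 : HasDerivAt (fun y => f2 (φ y)) (φ' x • f2' (φ x)) x :=
    (hf2 (φ x)).scomp x (hφ x hx)
  have hd2 : HasDerivAt (fun y => l y • A *ᵥ f1 y) (l x • A *ᵥ f1' x + l' x • A *ᵥ f1 x) x :=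
    (hl x hx).smul ((Matrix.mulVecLin A).toContinuousLinearMap.hasFDerivAt.comp_hasDerivAt x
      (hf1 x))
  have heq : (fun y => f2 (φ y)) =ᶠ[nhds x] fun y => l y • A *ᵥ f1 y := by
    filter_upwards [hX.mem_nhds hx] with y hy using h y hy
  rw [(hd1.congr_of_eventuallyEq heq.symm).unique hd2, add_comm]

/-! ### The action of Möbius transformations on Hankel matrices -/

/-- The `3 × 3` Hankel matrix with moments `m₀, …, m₄`. -/
def hankel (m0 m1 m2 m3 m4 : ℝ) : Matrix (Fin 3) (Fin 3) ℝ :=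
  !![m0, m1, m2; m1, m2, m3; m2, m3, m4]

theorem mobiusMatrix_mul (a b c d a' b' c' d' : ℝ) :
    mobiusMatrix a b c d * mobiusMatrix a' b' c' d' =
      mobiusMatrix (a * a' + b * c') (a * b' + b * d') (c * a' + d * c') (c * b' + d * d') := by
  ext i j
  fin_cases i <;> fin_cases j <;>
    simp [mobiusMatrix, Matrix.mul_apply, Fin.sum_univ_three] <;> ring

theorem det_mobiusMatrix (a b c d : ℝ) : (mobiusMatrix a b c d).det = (a * d - b * c) ^ 3 := by
  rw [mobiusMatrix, Matrix.det_fin_three]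
  simp
  ring

theorem isUnit_det_mobiusMatrix {a b c d : ℝ} (h : a * d - b * c ≠ 0) :
    IsUnit (mobiusMatrix a b c d).det := by
  rw [det_mobiusMatrix]
  exact (pow_ne_zero 3 h).isUnit

theorem mobiusMatrix_one : mobiusMatrix 1 0 0 1 = 1 := by
  ext i j
  fin_cases i <;> fin_cases j <;> simp [mobiusMatrix]

theorem mobiusOrbit_trans {L M N : Matrix (Fin 3) (Fin 3) ℝ} (h1 : N ∈ mobiusOrbit M)
    (h2 : M ∈ mobiusOrbit L) : N ∈ mobiusOrbit L := by
  obtain ⟨a, b, c, d, h, rfl⟩ := h1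
  obtain ⟨a', b', c', d', h', rfl⟩ := h2
  refine ⟨a * a' + b * c', a * b' + b * d', c * a' + d * c', c * b' + d * d', ?_, ?_⟩
  swap
  · rw [← mobiusMatrix_mul a b c d a' b' c' d', Matrix.transpose_mul]
    simp only [Matrix.mul_assoc]
  · have := mul_ne_zero h h'
    contrapose! this
    linear_combination this

theorem mobiusOrbit_symm {M N : Matrix (Fin 3) (Fin 3) ℝ} (h : N ∈ mobiusOrbit M) :
    M ∈ mobiusOrbit N := by
  obtain ⟨a, b, c, d, h, rfl⟩ := h
  set D := a * d - b * c with hD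
  have hmul : mobiusMatrix (d / D) (-b / D) (-c / D) (a / D) * mobiusMatrix a b c d = 1 := by
    rw [mobiusMatrix_mul, ← mobiusMatrix_one]
    congr 1 <;> field_simp <;> rw [hD] <;> ring
  refine ⟨d / D, -b / D, -c / D, a / D, ?_, ?_⟩
  · have : d / D * (a / D) - -b / D * (-c / D) = 1 / D := by
      field_simp
      rw [hD]; ring
    rw [this]
    exact one_div_ne_zero h
  · set A := mobiusMatrix a b c d
    set A' := mobiusMatrix (d / D) (-b / D) (-c / D) (a / D)
    calc M = (A' * A) * M * (A' * A)ᵀ := by rw [hmul]; simp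
      _ = A' * (A * M * Aᵀ) * A'ᵀ := by
        rw [Matrix.transpose_mul]; simp only [Matrix.mul_assoc]

theorem posDef_of_mem_mobiusOrbit {M N : Matrix (Fin 3) (Fin 3) ℝ} (hM : M.PosDef)
    (h : N ∈ mobiusOrbit M) : N.PosDef := by
  obtain ⟨a, b, c, d, h, rfl⟩ := h
  exact posDef_conj (isUnit_det_mobiusMatrix h) hM

/-- The transform of a Hankel matrix under the affine map `x ↦ (x - u) / t`, with the moments
multiplied by `t⁴`. -/
theorem hankel_affine_mem_mobiusOrbit (m0 m1 m2 m3 m4 u : ℝ) {t : ℝ} (ht : t ≠ 0) :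
    hankel (t ^ 4 * m0) (t ^ 3 * (m1 - u * m0)) (t ^ 2 * (m2 - 2 * u * m1 + u ^ 2 * m0))
      (t * (m3 - 3 * u * m2 + 3 * u ^ 2 * m1 - u ^ 3 * m0))
      (m4 - 4 * u * m3 + 6 * u ^ 2 * m2 - 4 * u ^ 3 * m1 + u ^ 4 * m0) ∈
      mobiusOrbit (hankel m0 m1 m2 m3 m4) := by
  refine ⟨1, -u, 0, t, by simpa using ht, ?_⟩
  ext i j
  fin_cases i <;> fin_cases j <;>
    simp [mobiusMatrix, hankel, Matrix.mul_apply, Fin.sum_univ_three] <;> ring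

/-- Under the rotation by `c - i s`, a Hankel matrix with moments `(m, b, e, -b, m)` keeps this
shape, and its component `W = (2m - 6e) - 8ib` gets multiplied by `(c - i s)⁴`. The hypothesis `hb`
says that the product is real. -/
theorem hankel_rotation_mem_mobiusOrbit (m b e c s : ℝ) (h : c ^ 2 + s ^ 2 ≠ 0)
    (hb : (c ^ 4 - 6 * c ^ 2 * s ^ 2 + s ^ 4) * (8 * b)
      + (4 * c ^ 3 * s - 4 * c * s ^ 3) * (2 * m - 6 * e) = 0) :
    ∃ n e', hankel n 0 e' 0 n ∈ mobiusOrbit (hankel m b e (-b) m) := by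
  -- The moments of `|z|⁴` and of `z⁴` determine the new matrix.
  let T := (c ^ 2 + s ^ 2) ^ 2 * (m + e)
  let R := (c ^ 4 - 6 * c ^ 2 * s ^ 2 + s ^ 4) * (2 * m - 6 * e)
    - (4 * c ^ 3 * s - 4 * c * s ^ 3) * (8 * b)
  refine ⟨(6 * T + R) / 8, (2 * T - R) / 8, c, s, -s, c,
    by contrapose! h; linear_combination h, ?_⟩
  ext i j
  fin_cases i <;> fin_cases j <;>
    simp [mobiusMatrix, hankel, Matrix.mul_apply, Fin.sum_univ_three, T, R]
  · ring
  · linear_combination -hb / 8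
  · ring
  · linear_combination -hb / 8
  · ring
  · linear_combination hb / 8
  · ring
  · linear_combination hb / 8
  · ring

/-- The Möbius matrix of `s⁻¹ • 1` is `s⁻²` times the identity, so the orbit is closed under positive
scaling. -/
theorem hankel_scale_mem_mobiusOrbit {n : ℝ} (e : ℝ) (hn : 0 < n) :
    hankel 1 0 (e / n) 0 1 ∈ mobiusOrbit (hankel n 0 e 0 n) := by
  have hs : 0 < √(√n) := by positivity
  have h4 : √(√n) ^ 4 = n := by
    rw [show √(√n) ^ 4 = (√(√n) ^ 2) ^ 2 by ring, Real.sq_sqrt (Real.sqrt_nonneg n),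
      Real.sq_sqrt hn.le]
  set s := √(√n)
  refine ⟨s⁻¹, 0, 0, s⁻¹, by simpa using hs.ne', ?_⟩
  rw [← h4]
  ext i j
  fin_cases i <;> fin_cases j <;>
    simp [mobiusMatrix, hankel, Matrix.mul_apply, Fin.sum_univ_three] <;> field_simp

/-- For a positive definite Hankel matrix there is a positive definite quadratic polynomial
`(x - u)² + t²` that is an eigenvector of the pencil `M - λ J`, where `J` is the discriminant form
`4 p₀ p₂ - p₁²`. The characteristic polynomial `det (M - λ J)` is positive at `0` and tends to
`-∞`, so it has a positive root, and `J` is positive at an eigenvector of a positive eigenvalue. -/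
theorem exists_definite_eigenvector {m0 m1 m2 m3 m4 : ℝ} (hM : (hankel m0 m1 m2 m3 m4).PosDef) :
    ∃ u t lam : ℝ, 0 < t ∧
      m0 * (u ^ 2 + t ^ 2) - 2 * u * m1 + m2 = 2 * lam ∧
      m1 * (u ^ 2 + t ^ 2) - 2 * u * m2 + m3 = 2 * u * lam ∧
      m2 * (u ^ 2 + t ^ 2) - 2 * u * m3 + m4 = 2 * lam * (u ^ 2 + t ^ 2) := by
  set M := hankel m0 m1 m2 m3 m4 with hMdef
  set J : Matrix (Fin 3) (Fin 3) ℝ := !![0, 0, 2; 0, -1, 0; 2, 0, 0] with hJ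
  set K : ℝ := m0 * m4 - 4 * m1 * m3 + 3 * m2 ^ 2
  have hdet : ∀ l : ℝ, (M - l • J).det = M.det + K * l - 4 * l ^ 3 := by
    intro l
    simp [hMdef, hJ, hankel, Matrix.det_fin_three, K]
    ring
  obtain ⟨l, hl0, hl⟩ : ∃ l : ℝ, 0 ≤ l ∧ (M - l • J).det = 0 := by
    have hd := hM.det_pos
    set L : ℝ := 1 + M.det + |K| with hL
    have hK := le_abs_self K
    have hK0 := abs_nonneg K
    -- At `L` the term `-4 L³` dominates, as `L ≥ 1`, `L ≥ |K|` and `L ≥ det M`.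
    have hL1 : 1 ≤ L := by linarith
    have hneg : M.det + K * L - 4 * L ^ 3 ≤ 0 := by
      nlinarith [mul_le_mul_of_nonneg_right (hK.trans (by linarith : |K| ≤ L))
        (by linarith : (0 : ℝ) ≤ L), mul_nonneg (sub_nonneg.2 hL1) (sq_nonneg L),
        mul_nonneg (sub_nonneg.2 hL1) (by linarith : (0 : ℝ) ≤ L)]
    obtain ⟨l, hl, h⟩ := intermediate_value_Icc' (f := fun l => (M - l • J).det)
      (by linarith : (0 : ℝ) ≤ L) (by simp only [hdet]; fun_prop)
      (show (0 : ℝ) ∈ Set.Icc _ _ by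
        constructor
        · rw [hdet]; exact hneg
        · simpa using hd.le)
    exact ⟨l, hl.1, h⟩
  obtain ⟨p, hp0, hp⟩ := Matrix.exists_mulVec_eq_zero_iff.mpr hl
  have hpos : 0 < p ⬝ᵥ M *ᵥ p := by simpa using hM.dotProduct_mulVec_pos hp0
  have e0 := congrFun hp 0
  have e1 := congrFun hp 1
  have e2 := congrFun hp 2
  simp [hMdef, hJ, hankel, Matrix.mulVec, dotProduct, Fin.sum_univ_three] at e0 e1 e2 hpos
  have hdisc : 0 < l * (4 * p 0 * p 2 - p 1 ^ 2) := by
    have : l * (4 * p 0 * p 2 - p 1 ^ 2) = p 0 * (m0 * p 0 + m1 * p 1 + m2 * p 2) +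
        p 1 * (m1 * p 0 + m2 * p 1 + m3 * p 2) + p 2 * (m2 * p 0 + m3 * p 1 + m4 * p 2) := by
      linear_combination -(p 0) * e0 - p 1 * e1 - p 2 * e2
    rw [this]
    linarith
  have hD : 0 < 4 * p 0 * p 2 - p 1 ^ 2 := pos_of_mul_pos_right hdisc hl0
  have hp2 : p 2 ≠ 0 := by
    intro h
    rw [h] at hD
    nlinarith [sq_nonneg (p 1)]
  have ht : 0 < p 0 / p 2 - (-p 1 / (2 * p 2)) ^ 2 := by
    have : p 0 / p 2 - (-p 1 / (2 * p 2)) ^ 2 = (4 * p 0 * p 2 - p 1 ^ 2) / (4 * p 2 ^ 2) := by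
      field_simp
      ring
    rw [this]
    positivity
  refine ⟨-p 1 / (2 * p 2), √(p 0 / p 2 - (-p 1 / (2 * p 2)) ^ 2), l, Real.sqrt_pos.2 ht, ?_⟩
  rw [Real.sq_sqrt ht.le]
  refine ⟨?_, ?_, ?_⟩ <;> field_simp
  · linear_combination 4 * p 2 * e0
  · linear_combination 4 * p 2 * e1
  · linear_combination 4 * p 2 * e2

/-- Every positive definite Hankel matrix is Möbius equivalent to one with moments
`(1, 0, a, 0, 1)`. The definite eigenvector of `exists_definite_eigenvector` is moved to `x² + 1`,
and a rotation then removes the odd moments. -/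
theorem exists_mem_mobiusOrbit_normalForm {m0 m1 m2 m3 m4 : ℝ}
    (hM : (hankel m0 m1 m2 m3 m4).PosDef) :
    ∃ a, 0 < a ∧ a < 1 ∧ hankel m0 m1 m2 m3 m4 ∈ mobiusOrbit (hankel 1 0 a 0 1) := by
  obtain ⟨u, t, l, ht, h0, h1, h2⟩ := exists_definite_eigenvector hM
  have hA := hankel_affine_mem_mobiusOrbit m0 m1 m2 m3 m4 u ht.ne'
  set b := t ^ 3 * (m1 - u * m0)
  set e := t ^ 2 * (m2 - 2 * u * m1 + u ^ 2 * m0)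
  have hb : t * (m3 - 3 * u * m2 + 3 * u ^ 2 * m1 - u ^ 3 * m0) = -b := by
    simp only [b]
    linear_combination t * (h1 - u * h0)
  have hm : m4 - 4 * u * m3 + 6 * u ^ 2 * m2 - 4 * u ^ 3 * m1 + u ^ 4 * m0 = t ^ 4 * m0 := by
    linear_combination h2 - 2 * u * h1 + (u ^ 2 - t ^ 2) * h0
  rw [hb, hm] at hA
  obtain ⟨c, s, hcs, hrot⟩ : ∃ c s : ℝ, c ^ 2 + s ^ 2 ≠ 0 ∧
      (c ^ 4 - 6 * c ^ 2 * s ^ 2 + s ^ 4) * (8 * b)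
      + (4 * c ^ 3 * s - 4 * c * s ^ 3) * (2 * (t ^ 4 * m0) - 6 * e) = 0 := by
    by_cases hW : (⟨2 * (t ^ 4 * m0) - 6 * e, -8 * b⟩ : ℂ) = 0
    · refine ⟨1, 0, by norm_num, ?_⟩
      have := congrArg Complex.im hW
      simp only [Complex.zero_im] at this
      linear_combination -this
    · -- If `z⁴ = W`, then `(conj z)⁴ W = |W|²` is real.
      obtain ⟨z, hz⟩ := IsAlgClosed.exists_pow_nat_eq
        (⟨2 * (t ^ 4 * m0) - 6 * e, -8 * b⟩ : ℂ) (by norm_num : 0 < 4)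
      refine ⟨z.re, z.im, ?_, ?_⟩
      · intro h
        apply hW
        have : z = 0 := by
          rw [← Complex.normSq_eq_zero, Complex.normSq_apply]
          linear_combination h
        rw [← hz, this]
        norm_num
      · have hr := congrArg Complex.re hz
        have hi := congrArg Complex.im hz
        simp [pow_succ] at hr hi
        linear_combination (8 * b) * hr + (2 * (t ^ 4 * m0) - 6 * e) * hi
  obtain ⟨n, e', hR⟩ := hankel_rotation_mem_mobiusOrbit _ b e c s hcs hrot
  have hN := mobiusOrbit_trans hR hA
  have hn : 0 < n := by
    simpa [hankel] using (posDef_of_mem_mobiusOrbit hM hN).diag_pos (i := 0)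
  have hF := mobiusOrbit_trans (hankel_scale_mem_mobiusOrbit e' hn) hN
  have hPD := posDef_of_mem_mobiusOrbit hM hF
  refine ⟨e' / n, by simpa [hankel] using hPD.diag_pos (i := 1), ?_, mobiusOrbit_symm hF⟩
  have := hPD.dotProduct_mulVec_pos (x := ![1, 0, -1]) (by simp)
  simp [hankel, Matrix.mulVec, dotProduct, Fin.sum_univ_three] at this
  linarith

/-! ### The length functional of the two regressions -/

theorem hasDerivAt_polyVec (x : ℝ) : HasDerivAt polyVec ![0, 1, 2 * x] x := by
  rw [hasDerivAt_pi]
  intro i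
  fin_cases i
  · simpa [polyVec] using hasDerivAt_const x (1 : ℝ)
  · simpa [polyVec] using hasDerivAt_id' x
  · simpa [polyVec] using hasDerivAt_pow 2 x

theorem polyVec_ne_zero (x : ℝ) : polyVec x ≠ 0 := fun h => by
  simpa [polyVec] using congrFun h 0

theorem hasDerivAt_fourierVec (t : ℝ) : HasDerivAt fourierVec
    ![0, √2 * (Real.cos (2 * Real.pi * t) * (2 * Real.pi)),
      √2 * (-Real.sin (2 * Real.pi * t) * (2 * Real.pi))] t := by
  have h : HasDerivAt (fun t : ℝ => 2 * Real.pi * t) (2 * Real.pi) t := by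
    simpa using (hasDerivAt_id t).const_mul (2 * Real.pi)
  rw [hasDerivAt_pi]
  intro i
  fin_cases i
  · simpa [fourierVec] using hasDerivAt_const t (1 : ℝ)
  · simpa [fourierVec] using (h.sin).const_mul √2
  · simpa [fourierVec] using (h.cos).const_mul √2

theorem fourierVec_ne_zero (x : ℝ) : fourierVec x ≠ 0 := fun h => by
  simpa [fourierVec] using congrFun h 0

theorem volP_eq_of_mem_mobiusOrbit {M N : Matrix (Fin 3) (Fin 3) ℝ} (hM : M.PosDef)
    (h : N ∈ mobiusOrbit M) : volP N = volP M := by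
  obtain ⟨a, b, c, d, h, rfl⟩ := h
  -- The pole of `φ` is removed from the line, and `φ` misses at most the point `a / c`.
  have hopen : IsOpen {x : ℝ | c * x + d ≠ 0} := isOpen_ne_fun (by fun_prop) (by fun_prop)
  have hsub : ∀ p q : ℝ, (p ≠ 0 ∨ q ≠ 0) → {x : ℝ | p * x + q ≠ 0} =ᵐ[volume] Set.univ := by
    intro p q hpq
    rw [ae_eq_univ]
    refine Set.Subsingleton.measure_zero (fun x hx y hy => ?_) _
    simp only [Set.mem_compl_iff, Set.mem_ofPred_eq, not_not] at hx hy
    have hp : p ≠ 0 := by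
      rintro rfl
      rcases hpq with h | h
      · exact h rfl
      · exact h (by linarith)
    exact mul_left_cancel₀ hp (by linarith)
  refine tubeVolume_reparam hopen (hsub c d ?_) hasDerivAt_polyVec hasDerivAt_polyVec
    polyVec_ne_zero polyVec_ne_zero (isUnit_det_mobiusMatrix h) hM
    (φ := fun x => (a * x + b) / (c * x + d))
    (φ' := fun x => (a * (c * x + d) - (a * x + b) * c) / (c * x + d) ^ 2)
    (l := fun x => ((c * x + d) ^ 2)⁻¹)
    (l' := fun x => -(2 * (c * x + d) * c) / ((c * x + d) ^ 2) ^ 2) ?_ ?_ ?_ ?_ ?_ ?_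
  · by_contra! hcd
    rw [hcd.1, hcd.2] at h
    simp at h
  · intro x hx
    have h1 : HasDerivAt (fun x => a * x + b) a x := by
      simpa using ((hasDerivAt_id x).const_mul a).add_const b
    have h2 : HasDerivAt (fun x => c * x + d) c x := by
      simpa using ((hasDerivAt_id x).const_mul c).add_const d
    exact h1.div h2 hx
  · intro x hx y hy hxy
    simp only [Set.mem_ofPred_eq] at hx hy hxy
    rw [div_eq_div_iff hx hy] at hxy
    exact mul_left_cancel₀ h (by linear_combination hxy)
  · have : (fun x => (a * x + b) / (c * x + d)) '' {x : ℝ | c * x + d ≠ 0} =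
        {y : ℝ | -c * y + a ≠ 0} := by
      ext y
      constructor
      · rintro ⟨x, hx, rfl⟩
        simp only [Set.mem_ofPred_eq] at hx ⊢
        have : -c * ((a * x + b) / (c * x + d)) + a = (a * d - b * c) / (c * x + d) := by
          field_simp
          ring
        rw [this]
        exact div_ne_zero h hx
      · intro hy
        replace hy : a - c * y ≠ 0 := by
          simp only [Set.mem_ofPred_eq] at hy
          contrapose! hy
          linear_combination hy
        have h1 : c * ((d * y - b) / (a - c * y)) + d = (a * d - b * c) / (a - c * y) := by
          field_simp
          ring
        have h2 : a * ((d * y - b) / (a - c * y)) + b =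
            (a * d - b * c) * y / (a - c * y) := by
          rw [← mul_div_assoc, div_add' _ _ _ hy]
          ring
        refine ⟨(d * y - b) / (a - c * y), ?_, ?_⟩
        · simp only [Set.mem_ofPred_eq]
          rw [h1]
          exact div_ne_zero h hy
        · simp only
          rw [h1, h2]
          field_simp
    rw [this]
    refine hsub (-c) a ?_
    by_contra! hcd
    rw [neg_eq_zero.mp hcd.1, hcd.2] at h
    simp at h
  · intro x hx
    have h2 : HasDerivAt (fun x => c * x + d) c x := by
      simpa using ((hasDerivAt_id x).const_mul c).add_const d
    have h3 := (h2.pow 2).inv (pow_ne_zero 2 hx)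
    exact HasDerivAt.congr_deriv h3 (by simp)
  · exact fun x hx => inv_ne_zero (pow_ne_zero 2 hx)
  · intro x hx
    simp only [Set.mem_ofPred_eq] at hx
    have key : mobiusMatrix a b c d *ᵥ polyVec x =
        ![(c * x + d) ^ 2, (a * x + b) * (c * x + d), (a * x + b) ^ 2] := by
      ext i
      fin_cases i <;> simp [polyVec, mobiusMatrix] <;> ring
    rw [key]
    generalize c * x + d = k at hx
    ext i
    fin_cases i <;> simp [polyVec] <;> field_simp

theorem isUnit_det_fourierPolyMatrix : IsUnit fourierPolyMatrix.det := by
  have h2 : √2 * √2 = 2 := Real.mul_self_sqrt (by norm_num)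
  have : fourierPolyMatrix.det = -8 := by
    simp [fourierPolyMatrix, Matrix.det_fin_three]
    linear_combination -4 * h2
  rw [this]
  norm_num

/-- The change of variables `x = tan (π t)` between the two bases. -/
theorem fourierVec_arctan_div_pi (x : ℝ) :
    fourierVec (Real.arctan x / Real.pi) = (1 + x ^ 2)⁻¹ • fourierPolyMatrix *ᵥ polyVec x := by
  have hx : (1 + x ^ 2) ≠ 0 := by positivity
  have ht : 2 * Real.pi * (Real.arctan x / Real.pi) = 2 * Real.arctan x := by
    field_simp
  have hc := Real.cos_sq_arctan x
  have hsin : Real.sin (Real.arctan x) = x * Real.cos (Real.arctan x) := by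
    conv_rhs => rw [← Real.tan_arctan x, Real.arctan_tan (Real.neg_pi_div_two_lt_arctan x)
      (Real.arctan_lt_pi_div_two x)]
    rw [Real.tan_mul_cos (Real.cos_arctan_pos x).ne']
  rw [fourierVec, ht, Real.sin_two_mul, Real.cos_two_mul, hsin]
  ext i
  fin_cases i
  · simp [polyVec, fourierPolyMatrix]
    field_simp
  · simp [polyVec, fourierPolyMatrix]
    rw [show 2 * (x * Real.cos (Real.arctan x)) * Real.cos (Real.arctan x) =
      2 * x * Real.cos (Real.arctan x) ^ 2 by ring, hc]
    field_simp
  · simp [polyVec, fourierPolyMatrix]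
    rw [hc]
    field_simp
    ring

theorem volF_conj_fourierPolyMatrix {N : Matrix (Fin 3) (Fin 3) ℝ} (hN : N.PosDef) :
    volF (fourierPolyMatrix * N * fourierPolyMatrixᵀ) = volP N := by
  have hpi := Real.pi_pos
  refine tubeVolume_reparam isOpen_univ (Filter.EventuallyEq.refl _ _) hasDerivAt_polyVec
    hasDerivAt_fourierVec polyVec_ne_zero fourierVec_ne_zero isUnit_det_fourierPolyMatrix hN
    (φ := fun x => Real.arctan x / Real.pi) (φ' := fun x => 1 / (1 + x ^ 2) / Real.pi)
    (l := fun x => (1 + x ^ 2)⁻¹) (l' := fun x => -(2 * x) / (1 + x ^ 2) ^ 2)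
    (fun x _ => (Real.hasDerivAt_arctan x).div_const _) ?_ ?_ ?_
    (fun x _ => by positivity) (fun x _ => fourierVec_arctan_div_pi x)
  · intro x _ y _ h
    exact Real.arctan_injective ((div_left_inj' hpi.ne').mp h)
  · have : (fun x => Real.arctan x / Real.pi) '' Set.univ = Set.Ioo (-1 / 2) (1 / 2) := by
      ext t
      constructor
      · rintro ⟨x, -, rfl⟩
        have h1 := Real.neg_pi_div_two_lt_arctan x
        have h2 := Real.arctan_lt_pi_div_two x
        constructor
        · rw [lt_div_iff₀ hpi]; linarith
        · rw [div_lt_iff₀ hpi]; linarith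
      · rintro ⟨h1, h2⟩
        refine ⟨Real.tan (t * Real.pi), trivial, ?_⟩
        simp only
        rw [Real.arctan_tan (by nlinarith) (by nlinarith)]
        field_simp
    rw [this]
    exact Ioo_ae_eq_Ioc
  · intro x _
    have := ((hasDerivAt_pow 2 x).const_add 1).inv (by positivity)
    exact this.congr_deriv (by simp)

/-! ### The length at the normal form -/

theorem gramSpeed_normalForm {a : ℝ} (ha : 0 < a) (ha1 : a < 1) (x : ℝ) :
    gramSpeed (hankel 1 0 a 0 1)⁻¹ (polyVec x) ![0, 1, 2 * x] =
      √((1 - a ^ 2) / a * (1 + 6 * a * x ^ 2 + x ^ 4)) /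
        (1 + (1 / a - 3 * a) * x ^ 2 + x ^ 4) := by
  have h1 : 0 < 1 - a ^ 2 := by nlinarith
  have hinv : (hankel 1 0 a 0 1)⁻¹ =
      !![1 / (1 - a ^ 2), 0, -a / (1 - a ^ 2); 0, 1 / a, 0;
        -a / (1 - a ^ 2), 0, 1 / (1 - a ^ 2)] := by
    refine Matrix.inv_eq_right_inv ?_
    ext i j
    fin_cases i <;> fin_cases j <;>
      simp [hankel, Matrix.mul_apply, Fin.sum_univ_three] <;> field_simp <;> ring
  have huu : polyVec x ⬝ᵥ (hankel 1 0 a 0 1)⁻¹ *ᵥ polyVec x =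
      (1 + (1 / a - 3 * a) * x ^ 2 + x ^ 4) / (1 - a ^ 2) := by
    rw [hinv]
    simp [polyVec, dotProduct, Fin.sum_univ_three]
    field_simp
    ring
  have hgram : (polyVec x ⬝ᵥ (hankel 1 0 a 0 1)⁻¹ *ᵥ polyVec x) *
      (![0, 1, 2 * x] ⬝ᵥ (hankel 1 0 a 0 1)⁻¹ *ᵥ ![0, 1, 2 * x]) -
      (polyVec x ⬝ᵥ (hankel 1 0 a 0 1)⁻¹ *ᵥ ![0, 1, 2 * x]) ^ 2 =
      ((1 - a ^ 2) / a * (1 + 6 * a * x ^ 2 + x ^ 4)) / (1 - a ^ 2) ^ 2 := by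
    rw [hinv]
    simp [polyVec, dotProduct, Fin.sum_univ_three]
    field_simp
    ring
  rw [gramSpeed, hgram, huu, Real.sqrt_div' _ (by positivity), Real.sqrt_sq h1.le]
  field_simp

/-- The substitution `y = (x - x⁻¹) / R` maps each of the two half-lines bijectively onto the
line. -/
theorem setLIntegral_comp_sub_inv {R : ℝ} (hR : 0 < R) (g : ℝ → ℝ≥0∞) {s : Set ℝ}
    (hs : s = Set.Ioi 0 ∨ s = Set.Iio 0) :
    ∫⁻ x in s, ENNReal.ofReal |(1 + (x ^ 2)⁻¹) / R| * g ((x - x⁻¹) / R) = ∫⁻ y, g y := by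
  have hmeas : MeasurableSet s := by
    rcases hs with rfl | rfl
    · exact measurableSet_Ioi
    · exact measurableSet_Iio
  have hne : ∀ x ∈ s, x ≠ 0 := by
    rcases hs with rfl | rfl
    · exact fun x hx => ne_of_gt hx
    · exact fun x hx => ne_of_lt hx
  have hmul : ∀ x ∈ s, ∀ y ∈ s, 0 < x * y := by
    rcases hs with rfl | rfl
    · exact fun x hx y hy => mul_pos hx hy
    · exact fun x hx y hy => mul_pos_of_neg_of_neg hx hy
  rw [← lintegral_image_eq_lintegral_abs_deriv_mul hmeas
    (f := fun x => (x - x⁻¹) / R) (f' := fun x => (1 + (x ^ 2)⁻¹) / R)]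
  · suffices h : (fun x => (x - x⁻¹) / R) '' s = Set.univ by rw [h, setLIntegral_univ]
    refine Set.eq_univ_of_forall fun y => ?_
    have hsq : √((R * y) ^ 2 + 4) ^ 2 = (R * y) ^ 2 + 4 := Real.sq_sqrt (by positivity)
    have habs : |R * y| < √((R * y) ^ 2 + 4) := by
      rw [← Real.sqrt_sq_eq_abs]
      exact Real.sqrt_lt_sqrt (sq_nonneg _) (by linarith)
    obtain ⟨h1, h2⟩ := abs_lt.mp habs
    have key : ∀ x : ℝ, x ≠ 0 → x ^ 2 - R * y * x - 1 = 0 → (x - x⁻¹) / R = y := by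
      intro x hx h
      field_simp
      linear_combination h
    rcases hs with rfl | rfl
    · have hx : 0 < (R * y + √((R * y) ^ 2 + 4)) / 2 := by linarith
      exact ⟨_, hx, key _ hx.ne' (by linear_combination hsq / 4)⟩
    · have hx : (R * y - √((R * y) ^ 2 + 4)) / 2 < 0 := by linarith
      exact ⟨_, hx, key _ hx.ne (by linear_combination hsq / 4)⟩
  · intro x hx
    have h := (((hasDerivAt_id' x).sub (hasDerivAt_inv (hne x hx))).div_const R)
    exact (h.congr_deriv (by ring)).hasDerivWithinAt
  · intro x hx y hy hxy
    have hx0 := hne x hx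
    have hy0 := hne y hy
    have h1 : x - x⁻¹ = y - y⁻¹ := (div_left_inj' hR.ne').mp hxy
    have h2 : (x - y) * (x * y + 1) = 0 := by
      field_simp at h1
      linear_combination h1
    rcases mul_eq_zero.mp h2 with h | h
    · linarith
    · linarith [hmul x hx y hy]

/-- The total length of the chord bound over the line: `v = (1 + y²)⁻¹` has mean `1/2` with respect
to the Cauchy distribution. -/
theorem lintegral_weighted_cauchy {p q : ℝ} (hp : 0 ≤ p) (hq : 0 ≤ q) :
    ∫⁻ y : ℝ, ENNReal.ofReal ((p + (q - p) * (1 + y ^ 2)⁻¹) * (1 + y ^ 2)⁻¹) =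
      ENNReal.ofReal (Real.pi * (p + q) / 2) := by
  have hle : ∀ y : ℝ, (1 + y ^ 2)⁻¹ ≤ 1 := fun y => inv_le_one_of_one_le₀ (by nlinarith)
  have hpos : ∀ y : ℝ, 0 < (1 + y ^ 2)⁻¹ := fun y => by positivity
  have hint : Integrable fun y : ℝ => (p + (q - p) * (1 + y ^ 2)⁻¹) * (1 + y ^ 2)⁻¹ := by
    refine (integrable_inv_one_add_sq.const_mul (|p| + |q - p|)).mono'
      (by fun_prop) (Filter.Eventually.of_forall fun y => ?_)
    rw [norm_mul, Real.norm_of_nonneg (hpos y).le]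
    refine mul_le_mul_of_nonneg_right ((norm_add_le _ _).trans ?_) (hpos y).le
    rw [norm_mul, Real.norm_of_nonneg (hpos y).le, Real.norm_eq_abs, Real.norm_eq_abs]
    nlinarith [abs_nonneg (q - p), hle y]
  rw [← ofReal_integral_eq_lintegral_ofReal hint]
  · congr 1
    have hderiv : ∀ y : ℝ, HasDerivAt
        (fun y => (p + q) / 2 * Real.arctan y + (q - p) / 2 * (y / (1 + y ^ 2)))
        ((p + (q - p) * (1 + y ^ 2)⁻¹) * (1 + y ^ 2)⁻¹) y := by
      intro y
      have h0 : (1 + y ^ 2) ≠ 0 := by positivity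
      have h1 := (Real.hasDerivAt_arctan y).const_mul ((p + q) / 2)
      have h2 := ((hasDerivAt_id' y).div ((hasDerivAt_pow 2 y).const_add 1) h0).const_mul
        ((q - p) / 2)
      refine (h1.add h2).congr_deriv ?_
      field_simp
      push_cast
      ring
    have hlim : ∀ l : Filter ℝ, Filter.Tendsto (fun y : ℝ => y⁻¹) l (nhds 0) →
        Filter.Tendsto (fun y : ℝ => |y|) l Filter.atTop →
        Filter.Tendsto (fun y : ℝ => y / (1 + y ^ 2)) l (nhds 0) := by
      intro l hl habs
      refine squeeze_zero_norm' ?_ (by simpa using hl.abs)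
      filter_upwards [habs.eventually_gt_atTop 0] with y hy
      rw [norm_div, Real.norm_eq_abs, Real.norm_of_nonneg (by positivity),
        div_le_iff₀ (by positivity), ← sq_abs]
      field_simp
      linarith
    have ht := ((Real.tendsto_arctan_atTop.mono_right nhdsWithin_le_nhds).const_mul
      ((p + q) / 2)).add ((hlim _ tendsto_inv_atTop_zero
        Filter.tendsto_abs_atTop_atTop).const_mul ((q - p) / 2))
    have hb := ((Real.tendsto_arctan_atBot.mono_right nhdsWithin_le_nhds).const_mul
      ((p + q) / 2)).add ((hlim _ tendsto_inv_atBot_zero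
        Filter.tendsto_abs_atBot_atTop).const_mul ((q - p) / 2))
    rw [integral_of_hasDerivAt_of_tendsto hderiv hint hb ht]
    ring
  · refine Filter.Eventually.of_forall fun y => mul_nonneg ?_ (hpos y).le
    nlinarith [hle y, hpos y, mul_nonneg hq (hpos y).le,
      mul_nonneg hp (sub_nonneg.2 (hle y))]

/-- The pointwise lower bound. With `v = (1 + y²)⁻¹`, `y = (x - x⁻¹) / (2√r)`, the speed is
`√H(v) · v · |dy/dx|` for a concave function `H` on `[0, 1]`; the bound replaces `√H` by its chord
between `v = 0` and `v = 1`. -/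
theorem chord_le_gramSpeed {a : ℝ} (ha : 0 < a) (ha1 : a < 1) {x : ℝ} (hx : x ≠ 0) {R p q : ℝ}
    (hR : 0 < R) (hR2 : R ^ 2 = (1 - a) * (1 + 3 * a) / a)
    (hp2 : p ^ 2 = (1 + a) / (1 + 3 * a)) (hq2 : q ^ 2 = (1 + a) / 2) :
    |(1 + (x ^ 2)⁻¹) / R| * ((p + (q - p) * (1 + ((x - x⁻¹) / R) ^ 2)⁻¹) *
      (1 + ((x - x⁻¹) / R) ^ 2)⁻¹) ≤
    gramSpeed (hankel 1 0 a 0 1)⁻¹ (polyVec x) ![0, 1, 2 * x] := by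
  rw [gramSpeed_normalForm ha ha1]
  set D := 1 + (1 / a - 3 * a) * x ^ 2 + x ^ 4 with hDdef
  have hD : D = (1 - x ^ 2) ^ 2 + R ^ 2 * x ^ 2 := by
    rw [hDdef, hR2]
    field_simp
    ring
  have hDpos : 0 < D := by
    rw [hD]
    positivity
  have hv : (1 + ((x - x⁻¹) / R) ^ 2)⁻¹ = R ^ 2 * x ^ 2 / D := by
    rw [hD]
    field_simp
    ring
  have hv1 : R ^ 2 * x ^ 2 / D ≤ 1 := by
    rw [div_le_one hDpos, hD]
    nlinarith [sq_nonneg (1 - x ^ 2)]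
  have hv0 : 0 ≤ R ^ 2 * x ^ 2 / D := by positivity
  rw [hv, abs_of_pos (by positivity)]
  set v := R ^ 2 * x ^ 2 / D with hvdef
  have hlin : (1 + (x ^ 2)⁻¹) / R * ((p + (q - p) * v) * v) =
      R * (1 + x ^ 2) * (p + (q - p) * v) / D := by
    rw [hvdef]
    field_simp
    ring
  rw [hlin]
  refine div_le_div_of_nonneg_right (Real.le_sqrt_of_sq_le ?_) hDpos.le
  -- The chord of `√H` lies below `√` of the chord of `H`, which lies below `√H`.
  have hconv : (p + (q - p) * v) ^ 2 ≤ p ^ 2 + (q ^ 2 - p ^ 2) * v := by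
    nlinarith [mul_nonneg (mul_nonneg hv0 (sub_nonneg.2 hv1)) (sq_nonneg (q - p))]
  have hconc : (1 + x ^ 2) ^ 2 * (p ^ 2 + (q ^ 2 - p ^ 2) * v) ≤
      p ^ 2 * (1 + 6 * a * x ^ 2 + x ^ 4) := by
    have hdiff : p ^ 2 * (1 + 6 * a * x ^ 2 + x ^ 4) -
        (1 + x ^ 2) ^ 2 * (p ^ 2 + (q ^ 2 - p ^ 2) * v) =
        p ^ 2 * ((3 * a - 1) ^ 2 * (1 + a) / (2 * a) * x ^ 2 * (1 - x ^ 2) ^ 2 / D) := by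
      have hqp : q ^ 2 - p ^ 2 = p ^ 2 * ((3 * a - 1) / 2) := by
        rw [hq2, hp2]
        field_simp
        ring
      rw [hqp, hvdef, hR2]
      field_simp
      rw [hDdef]
      field_simp
      ring
    have : 0 ≤ p ^ 2 * ((3 * a - 1) ^ 2 * (1 + a) / (2 * a) * x ^ 2 * (1 - x ^ 2) ^ 2 / D) := by
      positivity
    linarith
  calc (R * (1 + x ^ 2) * (p + (q - p) * v)) ^ 2
      = R ^ 2 * ((1 + x ^ 2) ^ 2 * (p + (q - p) * v) ^ 2) := by ring
    _ ≤ R ^ 2 * ((1 + x ^ 2) ^ 2 * (p ^ 2 + (q ^ 2 - p ^ 2) * v)) := by gcongr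
    _ ≤ R ^ 2 * (p ^ 2 * (1 + 6 * a * x ^ 2 + x ^ 4)) := by gcongr
    _ = (1 - a ^ 2) / a * (1 + 6 * a * x ^ 2 + x ^ 4) := by
      rw [hR2, hp2]
      field_simp
      ring

theorem volP_eq_lintegral_gramSpeed {M : Matrix (Fin 3) (Fin 3) ℝ} (hM : M.PosDef) :
    volP M = 2 * ∫⁻ x, ENNReal.ofReal (gramSpeed M⁻¹ (polyVec x) ![0, 1, 2 * x]) := by
  rw [volP, tubeVolume_eq_lintegral_gramSpeed hM.inv Set.univ hasDerivAt_polyVec polyVec_ne_zero,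
    setLIntegral_univ]

theorem le_volP_normalForm {a : ℝ} (ha : 0 < a) (ha1 : a < 1)
    (hM : (hankel 1 0 a 0 1).PosDef) :
    ENNReal.ofReal (2 * Real.pi * (√((1 + a) / (1 + 3 * a)) + √((1 + a) / 2))) ≤
      volP (hankel 1 0 a 0 1) := by
  have h1a : 0 < 1 - a := by linarith
  set p := √((1 + a) / (1 + 3 * a))
  set q := √((1 + a) / 2)
  have hp : 0 ≤ p := Real.sqrt_nonneg _
  have hq : 0 ≤ q := Real.sqrt_nonneg _
  set R := √((1 - a) * (1 + 3 * a) / a)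
  have hR : 0 < R := Real.sqrt_pos.2 (by positivity)
  set F : ℝ → ℝ≥0∞ :=
    fun x => ENNReal.ofReal (gramSpeed (hankel 1 0 a 0 1)⁻¹ (polyVec x) ![0, 1, 2 * x])
  have hhalf : ∀ s : Set ℝ, s = Set.Ioi 0 ∨ s = Set.Iio 0 →
      ENNReal.ofReal (Real.pi * (p + q) / 2) ≤ ∫⁻ x in s, F x := by
    intro s hs
    have hne : ∀ x ∈ s, x ≠ 0 := by
      rcases hs with rfl | rfl
      · exact fun x hx => ne_of_gt hx
      · exact fun x hx => ne_of_lt hx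
    have hmeas : MeasurableSet s := by
      rcases hs with rfl | rfl
      · exact measurableSet_Ioi
      · exact measurableSet_Iio
    rw [← lintegral_weighted_cauchy hp hq, ← setLIntegral_comp_sub_inv hR _ hs]
    refine setLIntegral_mono' hmeas fun x hx => ?_
    rw [← ENNReal.ofReal_mul (abs_nonneg _)]
    exact ENNReal.ofReal_le_ofReal (chord_le_gramSpeed ha ha1 (hne x hx) hR
      (Real.sq_sqrt (by positivity)) (Real.sq_sqrt (by positivity))
      (Real.sq_sqrt (by positivity)))
  have hdisj : Disjoint (Set.Ioi (0 : ℝ)) (Set.Iio 0) :=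
    Set.disjoint_left.mpr fun x hx hx' => lt_asymm (Set.mem_Ioi.mp hx) hx'
  have hpi := Real.pi_pos
  calc ENNReal.ofReal (2 * Real.pi * (p + q))
      = 2 * (ENNReal.ofReal (Real.pi * (p + q) / 2) +
          ENNReal.ofReal (Real.pi * (p + q) / 2)) := by
        rw [← ENNReal.ofReal_add (by positivity) (by positivity), ← ENNReal.ofReal_ofNat 2,
          ← ENNReal.ofReal_mul (by norm_num)]
        congr 1
        ring
    _ ≤ 2 * ((∫⁻ x in Set.Ioi 0, F x) + ∫⁻ x in Set.Iio 0, F x) := by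
        gcongr
        · exact hhalf _ (Or.inl rfl)
        · exact hhalf _ (Or.inr rfl)
    _ = 2 * ∫⁻ x in Set.Ioi 0 ∪ Set.Iio 0, F x := by
        rw [lintegral_union measurableSet_Iio hdisj]
    _ ≤ 2 * ∫⁻ x, F x := by
        gcongr 2 * ?_
        exact setLIntegral_le_lintegral _ _
    _ = volP (hankel 1 0 a 0 1) := (volP_eq_lintegral_gramSpeed hM).symm

/-- With `p, q` the two roots on the right, `(p + q)² ≥ 4 p q`, and `(p q)² - 4/9` is a positive
multiple of `(3a - 1)²`. -/
theorem two_mul_sqrt_lt {a : ℝ} (ha : 0 < a) (h : a ≠ 1 / 3) :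
    2 * √(2 / 3) < √((1 + a) / (1 + 3 * a)) + √((1 + a) / 2) := by
  set p := √((1 + a) / (1 + 3 * a)) with hp
  set q := √((1 + a) / 2) with hq
  have hp0 : 0 ≤ p := Real.sqrt_nonneg _
  have hq0 : 0 ≤ q := Real.sqrt_nonneg _
  have hpq : 2 / 3 < p * q := by
    rw [hp, hq, ← Real.sqrt_mul (by positivity)]
    refine Real.lt_sqrt_of_sq_lt ?_
    have h3 : 0 < (3 * a - 1) ^ 2 := by
      have : 3 * a - 1 ≠ 0 := by
        contrapose! h
        linarith
      positivity
    rw [div_mul_div_comm, lt_div_iff₀ (by positivity)]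
    nlinarith
  have hs : √(2 / 3 : ℝ) ^ 2 = 2 / 3 := Real.sq_sqrt (by norm_num)
  refine lt_of_pow_lt_pow_left₀ 2 (by positivity) ?_
  nlinarith [sq_nonneg (p - q)]

theorem matrixThird_eq_hankel : matrixThird = hankel 1 0 (1 / 3) 0 1 := rfl

theorem posDef_matrixThird : matrixThird.PosDef := by
  refine Matrix.PosDef.of_dotProduct_mulVec_pos ?_ ?_
  · ext i j
    fin_cases i <;> fin_cases j <;> simp [matrixThird]
  · intro x hx
    have hform : star x ⬝ᵥ matrixThird *ᵥ x =
        (x 0 + x 2 / 3) ^ 2 + x 1 ^ 2 / 3 + 8 / 9 * x 2 ^ 2 := by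
      simp [matrixThird, Matrix.mulVec, dotProduct, Fin.sum_univ_three]
      ring
    rw [hform]
    have h0 : 0 ≤ (x 0 + x 2 / 3) ^ 2 + x 1 ^ 2 / 3 + 8 / 9 * x 2 ^ 2 := by positivity
    refine lt_of_le_of_ne h0 fun h => hx ?_
    have h2 : x 2 = 0 := by
      nlinarith [sq_nonneg (x 0 + x 2 / 3), sq_nonneg (x 1), sq_nonneg (x 2)]
    have h1 : x 1 = 0 := by
      nlinarith [sq_nonneg (x 0 + x 2 / 3), sq_nonneg (x 1), sq_nonneg (x 2)]
    have h3 : x 0 = 0 := by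
      rw [h1, h2] at h
      nlinarith [sq_nonneg (x 0)]
    ext i
    fin_cases i <;> assumption

/-- At `a = 1/3` the curve has constant speed `√(8/3)` in the angle `arctan x`. -/
theorem volP_matrixThird : volP matrixThird = ENNReal.ofReal (4 * Real.pi * √(2 / 3)) := by
  rw [volP_eq_lintegral_gramSpeed posDef_matrixThird, matrixThird_eq_hankel]
  have hspeed : ∀ x : ℝ, gramSpeed (hankel 1 0 (1 / 3) 0 1)⁻¹ (polyVec x) ![0, 1, 2 * x] =
      2 * √(2 / 3) * (1 + x ^ 2)⁻¹ := by
    intro x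
    rw [gramSpeed_normalForm (by norm_num) (by norm_num)]
    have h1 : (1 - (1 / 3 : ℝ) ^ 2) / (1 / 3) * (1 + 6 * (1 / 3) * x ^ 2 + x ^ 4) =
        (2 * (1 + x ^ 2)) ^ 2 * (2 / 3) := by ring
    rw [h1, Real.sqrt_mul (by positivity), Real.sqrt_sq (by positivity)]
    field_simp
    ring
  simp only [hspeed]
  rw [← ofReal_integral_eq_lintegral_ofReal (integrable_inv_one_add_sq.const_mul _)
    (Filter.Eventually.of_forall fun x => by positivity), integral_const_mul,
    integral_univ_inv_one_add_sq, ← ENNReal.ofReal_ofNat 2, ← ENNReal.ofReal_mul (by norm_num)]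
  congr 1
  ring

theorem volP_of_mem_mobiusOrbit_matrixThird {M : Matrix (Fin 3) (Fin 3) ℝ}
    (h : M ∈ mobiusOrbit matrixThird) : volP M = ENNReal.ofReal (4 * Real.pi * √(2 / 3)) := by
  rw [volP_eq_of_mem_mobiusOrbit posDef_matrixThird h, volP_matrixThird]

/-- Among the positive definite Hankel matrices, only those in the orbit of `M_{1/3}` do not exceed
the minimal length. -/
theorem lt_volP_or_mem_mobiusOrbit {M : Matrix (Fin 3) (Fin 3) ℝ} (hM : M.PosDef)
    (hH : M 0 2 = M 1 1) :
    ENNReal.ofReal (4 * Real.pi * √(2 / 3)) < volP M ∨ M ∈ mobiusOrbit matrixThird := by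
  have hsymm : ∀ i j, M i j = M j i := fun i j => by simpa using hM.isHermitian.apply j i
  have hMeq : M = hankel (M 0 0) (M 0 1) (M 0 2) (M 1 2) (M 2 2) := by
    ext i j
    fin_cases i <;> fin_cases j <;> simp [hankel, hH, hsymm 1 0, hsymm 2 0, hsymm 2 1]
  obtain ⟨a, ha, ha1, horb⟩ := exists_mem_mobiusOrbit_normalForm (hMeq ▸ hM)
  rw [← hMeq] at horb
  have hPD := posDef_of_mem_mobiusOrbit hM (mobiusOrbit_symm horb)
  by_cases h : a = 1 / 3
  · right
    rw [h, ← matrixThird_eq_hankel] at horb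
    exact horb
  · left
    rw [volP_eq_of_mem_mobiusOrbit hPD horb]
    refine lt_of_lt_of_le ?_ (le_volP_normalForm ha ha1 hPD)
    have := two_mul_sqrt_lt ha h
    have hpi := Real.pi_pos
    rw [ENNReal.ofReal_lt_ofReal_iff (by positivity)]
    nlinarith

/-! ### The cones of information matrices -/

theorem mem_informationMatrices_of_sum {n k : ℕ} {X : Set ℝ} {f : ℝ → Fin n → ℝ}
    {M : Matrix (Fin n) (Fin n) ℝ} (hM : M.PosDef) (x : Fin k → ℝ) (w : Fin k → ℝ)
    (hx : ∀ m, x m ∈ X) (hw : ∀ m, 0 ≤ w m)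
    (h : ∀ i j, M i j = ∑ m, w m * (f (x m) i * f (x m) j)) : M ∈ informationMatrices X f := by
  set ρ : Measure ℝ := ∑ m, ENNReal.ofReal (w m) • Measure.dirac (x m) with hρ
  have hfin : ∀ m, IsFiniteMeasure (ENNReal.ofReal (w m) • Measure.dirac (x m)) := fun m =>
    ⟨by simp⟩
  have hint : ∀ (g : ℝ → ℝ) m, Integrable g (ENNReal.ofReal (w m) • Measure.dirac (x m)) :=
    fun g m => (integrable_dirac (by simp)).smul_measure ENNReal.ofReal_ne_top
  have hres : ρ.restrict X = ρ := by
    refine Measure.restrict_eq_self_of_ae_mem ?_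
    rw [hρ, ae_finsetSum_measure_iff]
    refine fun m _ => Measure.ae_smul_measure ?_ _
    rw [ae_dirac_eq]
    exact hx m
  refine ⟨hM, ρ, ?_, fun i j => ?_, fun i j => ?_⟩
  · rw [hρ]; infer_instance
  · rw [IntegrableOn, hres, hρ]
    exact integrable_finsetSum_measure.mpr fun m _ => hint _ m
  · rw [hres, hρ, integral_finsetSum_measure fun m _ => hint _ m, h]
    refine Finset.sum_congr rfl fun m _ => ?_
    rw [integral_smul_measure, integral_dirac, ENNReal.toReal_ofReal (hw m), smul_eq_mul]

/-- The orbit of `M_{1/3}` is parametrized by the positive definite quadratic form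
`P = a² + b²`, `Q = ac + bd`, `R = c² + d²`, because `M_{1/3}` is rotation invariant. -/
theorem mobiusMatrix_mul_matrixThird_mul_transpose (a b c d : ℝ) :
    mobiusMatrix a b c d * matrixThird * (mobiusMatrix a b c d)ᵀ =
      hankel ((c ^ 2 + d ^ 2) ^ 2) ((c ^ 2 + d ^ 2) * (a * c + b * d))
        ((a * c + b * d) ^ 2 + (a * d - b * c) ^ 2 / 3)
        ((a * c + b * d) * (a ^ 2 + b ^ 2)) ((a ^ 2 + b ^ 2) ^ 2) := by
  ext i j
  fin_cases i <;> fin_cases j <;>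
    simp [mobiusMatrix, matrixThird, hankel, Matrix.mul_apply, Fin.sum_univ_three] <;> ring

/-- The elements of the orbit of `M_{1/3}` are represented by measures with three atoms: the
images of `0, ±√3`, with masses proportional to `8/9, 1/18, 1/18`, under an affine map. -/
theorem exists_atoms_of_mem_mobiusOrbit_matrixThird {M : Matrix (Fin 3) (Fin 3) ℝ}
    (h : M ∈ mobiusOrbit matrixThird) : ∃ x w : Fin 3 → ℝ, (∀ m, 0 ≤ w m) ∧
      ∀ i j, M i j = ∑ m, w m * (polyVec (x m) i * polyVec (x m) j) := by
  obtain ⟨a, b, c, d, h, rfl⟩ := h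
  rw [mobiusMatrix_mul_matrixThird_mul_transpose]
  have hR : 0 < c ^ 2 + d ^ 2 := by
    have h0 : 0 ≤ c ^ 2 + d ^ 2 := by positivity
    refine lt_of_le_of_ne h0 fun h0 => h ?_
    have hc : c = 0 := by nlinarith [sq_nonneg c, sq_nonneg d]
    have hd : d = 0 := by nlinarith [sq_nonneg c, sq_nonneg d]
    rw [hc, hd]
    ring
  have hP : a ^ 2 + b ^ 2 =
      ((a * c + b * d) ^ 2 + (a * d - b * c) ^ 2) / (c ^ 2 + d ^ 2) := by
    field_simp
    ring
  rw [hP]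
  generalize c ^ 2 + d ^ 2 = R at hR
  generalize a * c + b * d = Q
  generalize a * d - b * c = E
  have h3 : √3 ^ 2 = (3 : ℝ) := Real.sq_sqrt (by norm_num)
  have h4 : √3 ^ 4 = (9 : ℝ) := by
    rw [show √3 ^ 4 = (√3 ^ 2) ^ 2 by ring, h3]
    norm_num
  refine ⟨![Q / R, Q / R + √3 * (E / R), Q / R - √3 * (E / R)],
    ![R ^ 2 * (8 / 9), R ^ 2 * (1 / 18), R ^ 2 * (1 / 18)], ?_, ?_⟩
  · intro m
    fin_cases m <;> simp <;> positivity
  -- In the coordinates `y = Q / R`, `z = E / R` of centre and scale, the claim is a list of moments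
  -- of orders `0` to `4`.
  have hQ : Q = R * (Q / R) := by field_simp
  have hE : E = R * (E / R) := by field_simp
  generalize Q / R = y at hQ
  generalize E / R = z at hE
  subst hQ hE
  have hdiv : ((R * y) ^ 2 + (R * z) ^ 2) / R = R * (y ^ 2 + z ^ 2) := by field_simp
  rw [hdiv]
  have e2 : (R * y) ^ 2 + (R * z) ^ 2 / 3 = R ^ 2 * (8 / 9) * y ^ 2 +
      R ^ 2 * (1 / 18) * (y + √3 * z) ^ 2 + R ^ 2 * (1 / 18) * (y - √3 * z) ^ 2 := by
    linear_combination -(R ^ 2 * z ^ 2 / 9) * h3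
  have e3 : (R * y) * (R * (y ^ 2 + z ^ 2)) = R ^ 2 * (8 / 9) * y ^ 3 +
      R ^ 2 * (1 / 18) * (y + √3 * z) ^ 3 + R ^ 2 * (1 / 18) * (y - √3 * z) ^ 3 := by
    linear_combination -(R ^ 2 * y * z ^ 2 / 3) * h3
  have e4 : (R * (y ^ 2 + z ^ 2)) ^ 2 = R ^ 2 * (8 / 9) * y ^ 4 +
      R ^ 2 * (1 / 18) * (y + √3 * z) ^ 4 + R ^ 2 * (1 / 18) * (y - √3 * z) ^ 4 := by
    linear_combination -(R ^ 2 * y ^ 2 * z ^ 2 * (2 / 3)) * h3 - (R ^ 2 * z ^ 4 / 9) * h4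
  rw [e2, e3, e4]
  intro i j
  fin_cases i <;> fin_cases j <;> simp [hankel, polyVec, Fin.sum_univ_three] <;> ring

theorem mobiusOrbit_matrixThird_subset_momentConeP : mobiusOrbit matrixThird ⊆ momentConeP := by
  intro M hM
  obtain ⟨x, w, hw, h⟩ := exists_atoms_of_mem_mobiusOrbit_matrixThird hM
  exact mem_informationMatrices_of_sum (posDef_of_mem_mobiusOrbit posDef_matrixThird hM) x w
    (fun _ => Set.mem_univ _) hw h

theorem arctan_div_pi_mem_Ioc (x : ℝ) :
    Real.arctan x / Real.pi ∈ Set.Ioc (-1 / 2 : ℝ) (1 / 2) := by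
  have hpi := Real.pi_pos
  have h1 := Real.neg_pi_div_two_lt_arctan x
  have h2 := Real.arctan_lt_pi_div_two x
  constructor
  · rw [lt_div_iff₀ hpi]; linarith
  · rw [div_le_iff₀ hpi]; linarith

theorem conj_mem_momentConeF {M : Matrix (Fin 3) (Fin 3) ℝ} (hM : M ∈ mobiusOrbit matrixThird) :
    fourierPolyMatrix * M * fourierPolyMatrixᵀ ∈ momentConeF := by
  obtain ⟨x, w, hw, h⟩ := exists_atoms_of_mem_mobiusOrbit_matrixThird hM
  refine mem_informationMatrices_of_sum (posDef_conj isUnit_det_fourierPolyMatrix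
    (posDef_of_mem_mobiusOrbit posDef_matrixThird hM)) (fun m => Real.arctan (x m) / Real.pi)
    (fun m => w m * (1 + x m ^ 2) ^ 2) (fun m => arctan_div_pi_mem_Ioc _)
    (fun m => mul_nonneg (hw m) (by positivity)) fun i j => ?_
  have hsum : M = ∑ m, w m • Matrix.vecMulVec (polyVec (x m)) (polyVec (x m)) := by
    ext i j
    simp [Matrix.sum_apply, Matrix.vecMulVec_apply, h]
  have hterm : ∀ m, fourierPolyMatrix * Matrix.vecMulVec (polyVec (x m)) (polyVec (x m)) *
      fourierPolyMatrixᵀ = Matrix.vecMulVec (fourierPolyMatrix *ᵥ polyVec (x m))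
        (fourierPolyMatrix *ᵥ polyVec (x m)) := fun m => by
    rw [Matrix.mul_vecMulVec, Matrix.vecMulVec_mul, Matrix.vecMul_transpose]
  rw [hsum, Matrix.mul_sum, Matrix.sum_mul, Matrix.sum_apply]
  refine Finset.sum_congr rfl fun m _ => ?_
  rw [Matrix.mul_smul, Matrix.smul_mul, hterm, fourierVec_arctan_div_pi]
  have hx : 1 + x m ^ 2 ≠ 0 := by positivity
  simp only [Matrix.smul_apply, Matrix.vecMulVec_apply, Pi.smul_apply, smul_eq_mul]
  field_simp

theorem apply_zero_two_eq_apply_one_one_of_mem_momentConeP {M : Matrix (Fin 3) (Fin 3) ℝ}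
    (hM : M ∈ momentConeP) : M 0 2 = M 1 1 := by
  obtain ⟨-, ρ, -, -, h⟩ := hM
  rw [h, h]
  refine integral_congr_ae (Filter.Eventually.of_forall fun x => ?_)
  simp [polyVec]
  ring

/-- Every information matrix of the Fourier regression comes from a positive definite Hankel
matrix. The Hankel condition `N₀₂ = N₁₁` is the image of `M₁₁ + M₂₂ = 2 M₀₀`, that is, of
`sin² + cos² = 1`. -/
theorem exists_eq_conj_of_mem_momentConeF {M : Matrix (Fin 3) (Fin 3) ℝ} (hM : M ∈ momentConeF) :
    ∃ N : Matrix (Fin 3) (Fin 3) ℝ, N.PosDef ∧ N 0 2 = N 1 1 ∧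
      M = fourierPolyMatrix * N * fourierPolyMatrixᵀ := by
  obtain ⟨hPD, ρ, -, hint, h⟩ := hM
  have hB := isUnit_det_fourierPolyMatrix
  have hBi : IsUnit fourierPolyMatrix⁻¹.det :=
    Matrix.isUnit_nonsing_inv_det _ hB
  have htrace : M 1 1 + M 2 2 = 2 * M 0 0 := by
    rw [h, h, h, ← integral_add (hint 1 1) (hint 2 2), ← integral_const_mul]
    refine integral_congr_ae (Filter.Eventually.of_forall fun t => ?_)
    have h2 : √2 * √2 = 2 := Real.mul_self_sqrt (by norm_num)
    simp [fourierVec]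
    linear_combination (Real.sin (2 * Real.pi * t) ^ 2 + Real.cos (2 * Real.pi * t) ^ 2) * h2 +
      2 * Real.sin_sq_add_cos_sq (2 * Real.pi * t)
  obtain ⟨N, hN, hMN⟩ : ∃ N : Matrix (Fin 3) (Fin 3) ℝ, N.PosDef ∧
      M = fourierPolyMatrix * N * fourierPolyMatrixᵀ := by
    refine ⟨fourierPolyMatrix⁻¹ * M * fourierPolyMatrix⁻¹ᵀ, posDef_conj hBi hPD, ?_⟩
    calc M = (fourierPolyMatrix * fourierPolyMatrix⁻¹) * M *
          (fourierPolyMatrix * fourierPolyMatrix⁻¹)ᵀ := by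
          rw [Matrix.mul_nonsing_inv _ hB]; simp
      _ = _ := by rw [Matrix.transpose_mul]; simp only [Matrix.mul_assoc]
  refine ⟨N, hN, ?_, hMN⟩
  have hsymm : N 2 0 = N 0 2 := by simpa using hN.isHermitian.apply 0 2
  have h2 : √2 * √2 = 2 := Real.mul_self_sqrt (by norm_num)
  rw [hMN] at htrace
  simp [fourierPolyMatrix, Matrix.mul_apply, Matrix.vecMul, dotProduct, Fin.sum_univ_three, hsymm]
    at htrace
  linear_combination (-1 / 8) * htrace +
    (4 * N 1 1 + N 0 0 - 2 * N 0 2 + N 2 2) / 8 * h2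

/-! ### The minimizers -/

/-- If a functional exceeds the value `m` on `S` outside a subset `O` and is equal to `m` on `O`,
then `O ≠ ∅` is the set of its minimizers and `m` is its minimum. -/
theorem minimizers_eq_and_isLeast {α : Type*} {S O : Set α} {V : α → ℝ≥0∞} {m : ℝ≥0∞}
    (hO : O ⊆ S) (hne : O.Nonempty) (hm : ∀ x ∈ O, V x = m) (hS : ∀ x ∈ S, m < V x ∨ x ∈ O) :
    {x | x ∈ S ∧ ∀ y ∈ S, V x ≤ V y} = O ∧ IsLeast (V '' S) m := by
  have hle : ∀ x ∈ S, m ≤ V x := fun x hx =>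
    (hS x hx).elim le_of_lt fun h => (hm x h).ge
  obtain ⟨x₀, hx₀⟩ := hne
  refine ⟨Set.Subset.antisymm ?_ ?_, ⟨x₀, hO hx₀, hm x₀ hx₀⟩, ?_⟩
  · rintro x ⟨hx, hmin⟩
    exact (hS x hx).resolve_left fun h => absurd (hmin x₀ (hO hx₀))
      (not_le.mpr (by rwa [hm x₀ hx₀]))
  · exact fun x hx => ⟨hO hx, fun y hy => (hm x hx).trans_le (hle y hy)⟩
  · rintro _ ⟨x, hx, rfl⟩
    exact hle x hx

theorem mainTheorem1 :
    -- polynomial regression: the minimizers over the moment cone form the orbit of `M_{1/3}`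
    {M | M ∈ momentConeP ∧ ∀ N ∈ momentConeP, volP M ≤ volP N} = mobiusOrbit matrixThird ∧
    IsLeast (volP '' momentConeP) (ENNReal.ofReal (4 * Real.pi * √(2 / 3))) ∧
    -- Fourier regression: the same after the change of basis `B`
    {M | M ∈ momentConeF ∧ ∀ N ∈ momentConeF, volF M ≤ volF N} =
      {M | ∃ N ∈ mobiusOrbit matrixThird, M = fourierPolyMatrix * N * fourierPolyMatrixᵀ} ∧
    IsLeast (volF '' momentConeF) (ENNReal.ofReal (4 * Real.pi * √(2 / 3))) := by
  have hmem : matrixThird ∈ mobiusOrbit matrixThird :=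
    ⟨1, 0, 0, 1, by norm_num, by simp [mobiusMatrix_one]⟩
  have hP := minimizers_eq_and_isLeast mobiusOrbit_matrixThird_subset_momentConeP ⟨_, hmem⟩
    (fun _ => volP_of_mem_mobiusOrbit_matrixThird) fun M hM =>
      lt_volP_or_mem_mobiusOrbit hM.1 (apply_zero_two_eq_apply_one_one_of_mem_momentConeP hM)
  have hF := minimizers_eq_and_isLeast (S := momentConeF) (V := volF)
    (O := {M | ∃ N ∈ mobiusOrbit matrixThird, M = fourierPolyMatrix * N * fourierPolyMatrixᵀ})
    (m := ENNReal.ofReal (4 * Real.pi * √(2 / 3)))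
    (by rintro _ ⟨N, hN, rfl⟩; exact conj_mem_momentConeF hN) ⟨_, _, hmem, rfl⟩
    (by
      rintro _ ⟨N, hN, rfl⟩
      rw [volF_conj_fourierPolyMatrix (posDef_of_mem_mobiusOrbit posDef_matrixThird hN),
        volP_of_mem_mobiusOrbit_matrixThird hN])
    (by
      intro M hM
      obtain ⟨N, hN, hH, rfl⟩ := exists_eq_conj_of_mem_momentConeF hM
      rw [volF_conj_fourierPolyMatrix hN]
      exact (lt_volP_or_mem_mobiusOrbit hN hH).imp_right fun h => ⟨N, h, rfl⟩)
  exact ⟨hP.1, hP.2, hF.1, hF.2⟩
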